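/- Let $\mathbb F_q$ be the finite field with $q$ elements. A generalized Hadamard (GH) matrix $H(q,\lambda)$ is a matrix $H=(h_{ij})$ of order $n=q\lambda$ with entries in $\mathbb F_q$ such that, for all $1\le i<j\le n$, the multiset $\{h_{is}-h_{js} : 1\le s\le n\}$ contains every element of $\mathbb F_q$ exactly $\lambda$ times; it is normalized if its first row and first column are zero. A GH code of length $n$ over $\mathbb F_q$ is a code of the form $C_H=\bigcup_{\alpha\in\mathbb F_q}(F_H+\alpha\mathbf 1)$, where $H$ is a normalized GH matrix of order $n$ over $\mathbb F_q$, $F_H\subseteq\mathbb F_q^n$ is the set of rows of $H$, and $\mathbf 1$ is the all-one vector. The kernel of a code $C\subseteq\mathbb F_q^n$ is the linear subspace $\mathcal K(C)=\{x\in\mathbb F_q^n : \alpha x+C=C\text{ for all }\alpha\in\mathbb F_q\}$, and $\ker(C)=\dim_{\mathbb F_q}\mathcal K(C)$. Theorem. Let $q>2$ be a prime power. (i) For every integer $h\ge 2$ with $(q,h)\ne(3,2)$ and every integer $k\ge 0$, there exists a GH code $C_H$ of length $n=q^h$ over $\mathbb F_q$ with $\ker(C_H)=k$ if and only if $k\in\{1,2,\ldots,h+1\}$.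 (ii) For $q=3$ and $h=2$, and every integer $k\ge 0$, there exists a GH code $C_H$ of length $n=9$ over $\mathbb F_3$ with $\ker(C_H)=k$ if and only if $k\in\{2,3\}$. -/

import Mathlib

/-- `H` is a generalized Hadamard matrix `H(q, lam)` over the finite field `F` with `q` elements:
it is square of order `n = q * lam`, and for any two rows `i < j` the multiset of differences
`H i s - H j s` contains every element of `F` exactly `lam` times. -/
structure IsGHMatrix {F : Type*} [Field F] [Fintype F] {n : ℕ} (lam : ℕ)
    (H : Matrix (Fin n) (Fin n) F) : Prop where
  order_eq : n = Fintype.card F * lam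
  balanced : ∀ i j : Fin n, i < j → ∀ a : F, {s : Fin n | H i s - H j s = a}.ncard = lam

/-- The first row and the first column of `H` are zero. -/
structure IsNormalizedMatrix {F : Type*} [Field F] {n : ℕ}
    (H : Matrix (Fin n) (Fin n) F) : Prop where
  first_row : ∀ i j : Fin n, (i : ℕ) = 0 → H i j = 0
  first_col : ∀ i j : Fin n, (j : ℕ) = 0 → H i j = 0

/-- The code `F_H` consisting of the rows of `H`. -/
def rowCode {F : Type*} {n : ℕ} (H : Matrix (Fin n) (Fin n) F) : Set (Fin n → F) :=
  Set.range fun i : Fin n => H i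

/-- The code `C_H`: the union over `α` in `F` of the translates `F_H + α 𝟏`, where `𝟏` is the
all-one vector. -/
def ghCode {F : Type*} [Field F] {n : ℕ} (H : Matrix (Fin n) (Fin n) F) : Set (Fin n → F) :=
  ⋃ α : F, (fun v : Fin n → F => v + α • (1 : Fin n → F)) '' rowCode H

/-- `C` is a generalized Hadamard code of length `n` over `F`: it is the code `C_H` of some
normalized generalized Hadamard matrix `H` of order `n` over `F`. -/
def IsGHCode {F : Type*} [Field F] [Fintype F] {n : ℕ} (C : Set (Fin n → F)) : Prop :=
  ∃ (lam : ℕ) (H : Matrix (Fin n) (Fin n) F),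
    IsGHMatrix lam H ∧ IsNormalizedMatrix H ∧ C = ghCode H

/-- The kernel of a code `C`: the vectors `x` with `α x + C = C` for all scalars `α`. -/
def codeKernel {F : Type*} [Field F] {n : ℕ} (C : Set (Fin n → F)) :
    Submodule F (Fin n → F) where
  carrier := {x | ∀ α : F, (fun c : Fin n → F => α • x + c) '' C = C}
  zero_mem' := by
    intro α
    simp
  add_mem' := by
    intro x y hx hy α
    have e : (fun c : Fin n → F => α • (x + y) + c) '' C
        = (fun c : Fin n → F => α • x + c) '' ((fun c : Fin n → F => α • y + c) '' C) := by
      rw [Set.image_image]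
      simp only [smul_add, add_assoc]
    rw [e, hy α, hx α]
  smul_mem' := by
    intro b x hx α
    have e := hx (α * b)
    simpa only [mul_smul] using e

/-- The dimension over `F` of the kernel of `C`. -/
noncomputable def kerDim {F : Type*} [Field F] {n : ℕ} (C : Set (Fin n → F)) : ℕ :=
  Module.finrank F (codeKernel C)

/-! ### The kernel of a GH code -/

/-! The all-one vector lies in the kernel. The zero row puts the kernel inside the code, which has
at most `n * q = q ^ (h + 1)` words; hence `1 ≤ k ≤ h + 1`.

Existence uses Maiorana–McFarland matrices. The row `(u, v)` is `u ⬝ ρ_v(s) + f_v(s) + v ⬝ t`: rows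
with different `v` are separated by `t`, rows with equal `v` by the permutation `ρ_v`. With every
`ρ_v` trivial and a quadratic term attached to a single `v`, only the affine functions of `s`
survive in the kernel, which gives each `k ≥ 2`. With one `ρ_v` that turns no nonzero linear form
into a linear form, only constants survive, so `k = 1`. Such a permutation exists on `F` if `q ≥ 4`
and on `F ^ 2` if `q = 3`; as `t` needs a coordinate too, this misses only `(q, h) = (3, 2)`.

In that case `k = 1` is impossible. A count of the values of sums of two rows, using balance of the
columns, yields three rows `a`, `b`, `d` with constant sum (`exists_rows_sum_const`). The difference
`r` of rows `b` and `a`, together with any fourth row, then coordinatizes the nine columns. In these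
coordinates balance forces a shape of the rows that is stable under adding `r`
(`exists_row_add_eq`), so `r` is a nonconstant kernel vector. -/

theorem mem_ghCode {F : Type*} [Field F] {n : ℕ} {H : Matrix (Fin n) (Fin n) F} {x : Fin n → F} :
    x ∈ ghCode H ↔ ∃ (j : Fin n) (β : F), ∀ s, x s = H j s + β := by
  simp only [ghCode, rowCode, Set.mem_iUnion, Set.mem_image, Set.mem_range]
  constructor
  · rintro ⟨β, _, ⟨j, rfl⟩, rfl⟩
    exact ⟨j, β, fun s => by simp⟩
  · rintro ⟨j, β, h⟩
    exact ⟨β, H j, ⟨j, rfl⟩, by ext s; simp [h s]⟩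

/-- Adding constants preserves the code, so testing rows suffices; inclusion for both `α` and `-α`
gives equality. -/
theorem mem_codeKernel_ghCode {F : Type*} [Field F] {n : ℕ} {H : Matrix (Fin n) (Fin n) F}
    {x : Fin n → F} :
    x ∈ codeKernel (ghCode H) ↔
      ∀ (α : F) (i : Fin n), ∃ (j : Fin n) (β : F), ∀ s, α * x s + H i s = H j s + β := by
  change (∀ α : F, (fun c : Fin n → F => α • x + c) '' ghCode H = ghCode H) ↔ _
  constructor
  · intro h α i
    have h1 : α • x + H i ∈ ghCode H := by
      rw [← h α]
      exact ⟨H i, mem_ghCode.2 ⟨i, 0, by simp⟩, rfl⟩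
    simpa using mem_ghCode.1 h1
  · intro h
    have key : ∀ (α : F) (c : Fin n → F), c ∈ ghCode H → α • x + c ∈ ghCode H := by
      intro α c hc
      obtain ⟨i, γ, hi⟩ := mem_ghCode.1 hc
      obtain ⟨j, β, hj⟩ := h α i
      refine mem_ghCode.2 ⟨j, β + γ, fun s => ?_⟩
      simp only [Pi.add_apply, Pi.smul_apply, smul_eq_mul, hi s]
      linear_combination hj s
    intro α
    apply Set.Subset.antisymm
    · rintro _ ⟨c, hc, rfl⟩
      exact key α c hc
    · intro c hc
      exact ⟨(-α) • x + c, key _ c hc, by simp⟩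

theorem one_mem_codeKernel_ghCode {F : Type*} [Field F] {n : ℕ} (H : Matrix (Fin n) (Fin n) F) :
    (1 : Fin n → F) ∈ codeKernel (ghCode H) :=
  mem_codeKernel_ghCode.2 fun α i => ⟨i, α, fun s => by simp [add_comm]⟩

theorem one_le_kerDim {F : Type*} [Field F] {n : ℕ} (hn : n ≠ 0) (H : Matrix (Fin n) (Fin n) F) :
    1 ≤ kerDim (ghCode H) := by
  rw [kerDim, Nat.one_le_iff_ne_zero, Ne, Submodule.finrank_eq_zero]
  intro h
  have h1 := one_mem_codeKernel_ghCode H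
  rw [h, Submodule.mem_bot] at h1
  exact one_ne_zero (congrFun h1 ⟨0, Nat.pos_of_ne_zero hn⟩)

/-- The first row is zero, so every kernel vector is itself a row plus a constant. -/
theorem kerDim_ghCode_le {F : Type*} [Field F] [Fintype F] {n h : ℕ}
    (hn : n = Fintype.card F ^ h) {H : Matrix (Fin n) (Fin n) F} (hH : IsNormalizedMatrix H) :
    kerDim (ghCode H) ≤ h + 1 := by
  classical
  have hq : 1 < Fintype.card F := Fintype.one_lt_card
  have hn0 : 0 < n := hn ▸ pow_pos (by omega) h
  have hex : ∀ x : codeKernel (ghCode H), ∃ p : Fin n × F, ∀ s, (x : Fin n → F) s = H p.1 s + p.2 := by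
    rintro ⟨x, hx⟩
    obtain ⟨j, β, hj⟩ := mem_codeKernel_ghCode.1 hx 1 ⟨0, hn0⟩
    refine ⟨(j, β), fun s => ?_⟩
    have := hj s
    rw [hH.first_row _ _ rfl] at this
    simpa using this
  choose g hg using hex
  have hinj : Function.Injective g := by
    intro x y hxy
    ext s
    rw [hg x s, hg y s, hxy]
  have hc := Nat.card_le_card_of_injective g hinj
  rw [Module.natCard_eq_pow_finrank (K := F), Nat.card_eq_fintype_card, Nat.card_prod,
    Nat.card_eq_fintype_card, Nat.card_eq_fintype_card, Fintype.card_fin] at hc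
  have hc := hc.trans_eq (congrArg (· * Fintype.card F) hn)
  rw [← pow_succ] at hc
  exact (Nat.pow_le_pow_iff_right hq).1 hc

/-- A GH matrix indexed by an arbitrary finite type yields a GH code, whose kernel is the space of
the vectors that translate the rows to rows, up to constants. -/
theorem exists_isGHCode_of_index {F ι : Type*} [Field F] [Fintype F] [Fintype ι] {n lam : ℕ}
    (hn : Fintype.card ι = n) (hlam : n = Fintype.card F * lam) (H : ι → ι → F) (i₀ j₀ : ι)
    (hrow : ∀ s, H i₀ s = 0) (hcol : ∀ i, H i j₀ = 0)
    (hbal : ∀ i j, i ≠ j → ∀ a, {s | H i s - H j s = a}.ncard = lam)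
    (K : Submodule F (ι → F))
    (hK : ∀ x, x ∈ K ↔ ∀ (α : F) (i : ι), ∃ (j : ι) (β : F), ∀ s, α * x s + H i s = H j s + β) :
    ∃ C : Set (Fin n → F), IsGHCode C ∧ kerDim C = Module.finrank F K := by
  classical
  have hn0 : 0 < n := hn ▸ Fintype.card_pos_iff.2 ⟨i₀⟩
  have hexe : ∀ k : ι, ∃ e : Fin n ≃ ι, e ⟨0, hn0⟩ = k := by
    intro k
    let e := (Fintype.equivFinOfCardEq hn).symm
    exact ⟨e.trans (Equiv.swap (e ⟨0, hn0⟩) k), by simp⟩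
  obtain ⟨e, he⟩ := hexe i₀
  obtain ⟨e', he'⟩ := hexe j₀
  let H' : Matrix (Fin n) (Fin n) F := fun i s => H (e i) (e' s)
  refine ⟨ghCode H', ⟨lam, H', ⟨hlam, ?_⟩, ⟨?_, ?_⟩, rfl⟩, ?_⟩
  · intro i j hij a
    rw [← hbal (e i) (e j) (fun h => hij.ne (e.injective h)) a]
    rw [← Set.ncard_image_of_injective _ e'.injective]
    congr 1
    ext s
    simp only [Set.mem_image, Set.mem_ofPred_eq, H']
    constructor
    · rintro ⟨t, ht, rfl⟩
      exact ht
    · intro hs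
      exact ⟨e'.symm s, by simpa using hs, by simp⟩
  · intro i j hi
    have : i = ⟨0, hn0⟩ := Fin.ext hi
    simp [H', this, he, hrow]
  · intro i j hj
    have : j = ⟨0, hn0⟩ := Fin.ext hj
    simp [H', this, he', hcol]
  · have hmap : codeKernel (ghCode H') = K.map (LinearEquiv.funCongrLeft F F e').toLinearMap := by
      ext x
      rw [Submodule.mem_map_equiv, mem_codeKernel_ghCode, hK]
      constructor
      · intro h α i
        obtain ⟨j, β, hj⟩ := h α (e.symm i)
        refine ⟨e j, β, fun s => ?_⟩
        simpa [H', LinearEquiv.funCongrLeft, LinearMap.funLeft] using hj (e'.symm s)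
      · intro h α i
        obtain ⟨j, β, hj⟩ := h α (e i)
        refine ⟨e.symm j, β, fun s => ?_⟩
        simpa [H', LinearEquiv.funCongrLeft, LinearMap.funLeft] using hj (e' s)
    rw [kerDim, hmap]
    exact LinearEquiv.finrank_map_eq _ _

/-- The maps `φ` inject each fibre of `f` into every other one, so all fibres have the same size. -/
theorem ncard_fiber_mul_card {F ι : Type*} [Field F] [Fintype F] [Fintype ι] (f : ι → F)
    (hf : ∀ d : F, ∃ φ : ι → ι, Function.Injective φ ∧ ∀ x, f (φ x) = f x + d) (a : F) :
    Fintype.card F * {x | f x = a}.ncard = Fintype.card ι := by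
  classical
  have hle : ∀ b c : F, {x | f x = b}.ncard ≤ {x | f x = c}.ncard := by
    intro b c
    obtain ⟨φ, hφ, h⟩ := hf (c - b)
    refine Set.ncard_le_ncard_of_injOn φ (fun x hx => ?_) hφ.injOn
    have hx' : f x = b := hx
    simp [h, hx']
  have hsum : Fintype.card ι = ∑ b : F, {x | f x = b}.ncard := by
    rw [← Finset.card_univ, Finset.card_eq_sum_card_fiberwise (f := f) (t := Finset.univ) (by simp)]
    refine Finset.sum_congr rfl fun b _ => ?_
    rw [← Set.ncard_coe_finset]
    simp
  rw [hsum, Finset.sum_congr rfl fun b _ => le_antisymm (hle b a) (hle a b)]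
  simp

/-! ### A Maiorana–McFarland type construction -/

theorem exists_dotProduct_eq_one {F : Type*} [Field F] {a : ℕ} {u : Fin a → F} (hu : u ≠ 0) :
    ∃ s, u ⬝ᵥ s = 1 := by
  obtain ⟨i, hi⟩ := Function.ne_iff.1 hu
  exact ⟨Pi.single i (u i)⁻¹, by simpa using mul_inv_cancel₀ hi⟩

/-- The matrix with entries `u ⬝ ρ_v(s) + f_v(s) + v ⬝ t` in row `(u, v)` and column `(s, t)`. -/
def mmMatrix {F : Type*} [Field F] {a b : ℕ} (ρ : (Fin b → F) → Equiv.Perm (Fin a → F))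
    (f : (Fin b → F) → (Fin a → F) → F) (i j : (Fin a → F) × (Fin b → F)) : F :=
  i.1 ⬝ᵥ ρ i.2 j.1 + f i.2 j.1 + i.2 ⬝ᵥ j.2

theorem mmMatrix_balanced {F : Type*} [Field F] [Fintype F] {a b : ℕ}
    (ρ : (Fin b → F) → Equiv.Perm (Fin a → F)) (f : (Fin b → F) → (Fin a → F) → F)
    {i j : (Fin a → F) × (Fin b → F)} (hij : i ≠ j) (x : F) :
    Fintype.card F * {s | mmMatrix ρ f i s - mmMatrix ρ f j s = x}.ncard =
      Fintype.card F ^ (a + b) := by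
  rw [ncard_fiber_mul_card (fun s => mmMatrix ρ f i s - mmMatrix ρ f j s) ?_ x]
  · simp [Fintype.card_prod, pow_add]
  · intro d
    obtain ⟨u, v⟩ := i
    obtain ⟨u', v'⟩ := j
    by_cases hv : v = v'
    · subst hv
      have hu : u - u' ≠ 0 := sub_ne_zero.2 fun h => hij (by rw [h])
      obtain ⟨s₀, hs₀⟩ := exists_dotProduct_eq_one hu
      -- Translation is conjugated by `ρ v`, so that the difference of the two rows changes by
      -- exactly `d`.
      refine ⟨fun p => ((ρ v).symm (ρ v p.1 + d • s₀), p.2), ?_, ?_⟩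
      · rintro ⟨s, t⟩ ⟨s', t'⟩ h
        simpa using h
      · rintro ⟨s, t⟩
        rw [sub_dotProduct] at hs₀
        simp only [mmMatrix, Equiv.apply_symm_apply, dotProduct_add, dotProduct_smul, smul_eq_mul]
        linear_combination d * hs₀
    · obtain ⟨t₀, ht₀⟩ := exists_dotProduct_eq_one (sub_ne_zero.2 hv)
      refine ⟨fun p => (p.1, p.2 + d • t₀), ?_, ?_⟩
      · rintro ⟨s, t⟩ ⟨s', t'⟩ h
        simpa using h
      · rintro ⟨s, t⟩
        rw [sub_dotProduct] at ht₀
        simp only [mmMatrix, dotProduct_add, dotProduct_smul, smul_eq_mul]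
        linear_combination d * ht₀

/-- The row of `mmMatrix` with `v = 0`, plus a constant. -/
def affineMap (F : Type*) [Field F] (a b : ℕ) :
    F × (Fin a → F) →ₗ[F] ((Fin a → F) × (Fin b → F) → F) where
  toFun p j := p.1 + p.2 ⬝ᵥ j.1
  map_add' p p' := by
    ext j
    simp only [Prod.fst_add, Prod.snd_add, add_dotProduct, Pi.add_apply]
    ring
  map_smul' c p := by
    ext j
    simp [smul_dotProduct, mul_add]

theorem finrank_range_affineMap (F : Type*) [Field F] (a b : ℕ) :
    Module.finrank F (LinearMap.range (affineMap F a b)) = a + 1 := by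
  rw [LinearMap.finrank_range_of_inj]
  · simp [add_comm]
  · rintro ⟨β, u⟩ ⟨β', u'⟩ h
    have h1 : ∀ s, β + u ⬝ᵥ s = β' + u' ⬝ᵥ s := fun s => congrFun h (s, 0)
    have h0 : β = β' := by simpa using h1 0
    subst h0
    have h2 : u = u' := by
      ext i
      simpa using h1 (Pi.single i 1)
    rw [h2]

theorem exists_ne_zero_ne_one {F : Type*} [Field F] [Fintype F] (hq : 2 < Fintype.card F) :
    ∃ x : F, x ≠ 0 ∧ x ≠ 1 := by
  classical
  obtain ⟨x, hx⟩ := Finset.exists_mem_notMem_of_card_lt_card (s := {0, 1}) (t := Finset.univ)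
    (lt_of_le_of_lt (Finset.card_le_two (a := (0 : F)) (b := 1)) (by simpa using hq))
  exact ⟨x, by simp_all⟩

theorem exists_kerDim_eq_succ {F : Type*} [Field F] [Fintype F] (hq : 2 < Fintype.card F) {n a b : ℕ}
    (hn : n = Fintype.card F ^ (a + 1 + b)) :
    ∃ C : Set (Fin n → F), IsGHCode C ∧ kerDim C = a + 1 + 1 := by
  classical
  obtain ⟨x, hx0, hx1⟩ := exists_ne_zero_ne_one hq
  have hxx : x * x - x ≠ 0 := by
    have : x * (x - 1) ≠ 0 := mul_ne_zero hx0 (sub_ne_zero.2 hx1)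
    rwa [mul_sub, mul_one] at this
  -- The clause `v ≠ 0` matters only for `b = 0`, where `1 = 0`; it keeps the zero row zero.
  let c : (Fin b → F) → F := fun v => if v = 1 ∧ v ≠ 0 then 1 else 0
  have hc0 : c 0 = 0 := by simp [c]
  have hc : ∀ v, (∀ (α : F) v', c (α • v + v') = α * c v + c v') → v = 0 := by
    intro v hv
    by_contra hv0
    by_cases hv1 : v = 1
    · have h1 : c v = 1 := by simp only [c]; rw [if_pos ⟨hv1, hv0⟩]
      have h2 : c (x • v) = 0 := by
        simp only [c]
        rw [if_neg]
        rintro ⟨h, -⟩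
        rw [hv1] at h hv0
        obtain ⟨i, hi⟩ := Function.ne_iff.1 hv0
        exact hx1 (by simpa using congrFun h i)
      have := hv x 0
      rw [add_zero, h2, h1, hc0] at this
      exact hx0 (by simpa using this.symm)
    · have h1 : c v = 0 := by simp only [c]; rw [if_neg (fun h => hv1 h.1)]
      have he : (1 : Fin b → F) ≠ 0 := by
        intro h
        obtain ⟨i, hi⟩ := Function.ne_iff.1 hv0
        simpa using congrFun h i
      have h2 : c 1 = 1 := by simp [c, he]
      have h3 : c (v + 1) = 0 := by simp [c, hv0]
      have := hv 1 1
      rw [one_smul, h3, h1, h2] at this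
      simp at this
  let f : (Fin b → F) → (Fin (a + 1) → F) → F := fun v s => c v * (s 0 * s 0)
  have hcard : Fintype.card ((Fin (a + 1) → F) × (Fin b → F)) = n := by
    simp [hn, pow_add]
  have hn' : n = Fintype.card F * Fintype.card F ^ (a + b) := by
    rw [hn]; ring
  have hq0 : 0 < Fintype.card F := by omega
  rw [← finrank_range_affineMap F (a + 1) b]
  refine exists_isGHCode_of_index hcard hn' (mmMatrix (fun _ => 1) f) 0 0 ?_ ?_ ?_ _ ?_
  · rintro ⟨s, t⟩
    simp [mmMatrix, f, hc0]
  · rintro ⟨u, v⟩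
    simp [mmMatrix, f]
  · intro i j hij y
    have := mmMatrix_balanced (fun _ => 1) f hij y
    rw [← hn, hn'] at this
    exact Nat.eq_of_mul_eq_mul_left hq0 this
  · intro y
    constructor
    · rintro ⟨⟨β, u⟩, rfl⟩ α ⟨u', v'⟩
      refine ⟨(α • u + u', v'), α * β, ?_⟩
      rintro ⟨s, t⟩
      simp only [mmMatrix, affineMap, LinearMap.coe_mk, AddHom.coe_mk, add_dotProduct, smul_dotProduct,
        Equiv.Perm.one_apply, smul_eq_mul]
      ring
    · intro h
      obtain ⟨⟨u, v⟩, β, hy⟩ := h 1 0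
      replace hy : ∀ s t, y (s, t) = u ⬝ᵥ s + c v * (s 0 * s 0) + v ⬝ᵥ t + β := by
        intro s t
        simpa [mmMatrix, f, hc0] using hy (s, t)
      have hv : v = 0 := by
        refine hc v fun α v' => ?_
        obtain ⟨⟨u'', v''⟩, β', hj⟩ := h α (0, v')
        replace hj : ∀ s t, α * (u ⬝ᵥ s + c v * (s 0 * s 0) + v ⬝ᵥ t + β) +
            (c v' * (s 0 * s 0) + v' ⬝ᵥ t) = u'' ⬝ᵥ s + c v'' * (s 0 * s 0) + v'' ⬝ᵥ t + β' := by
          intro s t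
          simpa [mmMatrix, f, hy] using hj (s, t)
        have hβ : α * β = β' := by simpa using hj 0 0
        subst hβ
        have hv'' : v'' = α • v + v' := by
          ext i
          have := hj 0 (Pi.single i 1)
          simp at this
          simp only [Pi.add_apply, Pi.smul_apply, smul_eq_mul]
          linear_combination -this
        subst hv''
        have e1 := hj (Pi.single 0 1) 0
        have e2 := hj (Pi.single 0 x) 0
        simp at e1 e2
        -- Eliminating the linear term between `s 0 = 1` and `s 0 = x` leaves the quadratic
        -- coefficient times `x * x - x`.
        have : (c (α • v + v') - (α * c v + c v')) * (x * x - x) = 0 := by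
          linear_combination x * e1 - e2
        exact sub_eq_zero.1 ((mul_eq_zero.1 this).resolve_right hxx)
      subst hv
      refine ⟨(β, u), ?_⟩
      ext ⟨s, t⟩
      simp [affineMap, hy, hc0, add_comm]

/-- Only `v = 1` carries `ρ₀`, and `b + 1` coordinates ensure `1 ≠ 0`. A kernel vector with `v ≠ 0`
would make a nonzero component of `ρ₀` linear; one with `v = 0` and `u ≠ 0` would turn, at `v' = 1`,
a linear form into a component of `ρ₀`. -/
theorem exists_kerDim_eq_one {F : Type*} [Field F] [Fintype F] (hq : 2 < Fintype.card F) {n a b : ℕ}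
    (hn : n = Fintype.card F ^ (a + (b + 1))) (ρ₀ : Equiv.Perm (Fin a → F)) (hρ : ρ₀ 0 = 0)
    (hlin : ∀ u w : Fin a → F, (∀ s, u ⬝ᵥ s = w ⬝ᵥ ρ₀ s) → u = 0) (ha : a ≠ 0) :
    ∃ C : Set (Fin n → F), IsGHCode C ∧ kerDim C = 1 := by
  classical
  let ρ : (Fin (b + 1) → F) → Equiv.Perm (Fin a → F) := fun v => if v = 1 then ρ₀ else 1
  have hρ1 : ρ 1 = ρ₀ := by simp [ρ]
  have hρ' : ∀ v, v ≠ 1 → ρ v = 1 := fun v hv => by simp [ρ, hv]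
  have hρ0 : ∀ v, ρ v 0 = 0 := by
    intro v
    by_cases hv : v = 1
    · rw [hv, hρ1, hρ]
    · rw [hρ' v hv]; rfl
  have hcard : Fintype.card ((Fin a → F) × (Fin (b + 1) → F)) = n := by
    simp [hn, pow_add]
  have hn' : n = Fintype.card F * Fintype.card F ^ (a + b) := by
    rw [hn]; ring
  have hq0 : 0 < Fintype.card F := by omega
  have hne : (1 : (Fin a → F) × (Fin (b + 1) → F) → F) ≠ 0 := one_ne_zero
  rw [← finrank_span_singleton (K := F) hne]
  refine exists_isGHCode_of_index hcard hn' (mmMatrix ρ 0) 0 0 ?_ ?_ ?_ _ ?_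
  · rintro ⟨s, t⟩
    simp [mmMatrix]
  · rintro ⟨u, v⟩
    simp [mmMatrix, hρ0]
  · intro i j hij y
    have := mmMatrix_balanced ρ 0 hij y
    rw [← hn, hn'] at this
    exact Nat.eq_of_mul_eq_mul_left hq0 this
  · intro y
    rw [Submodule.mem_span_singleton]
    constructor
    · rintro ⟨β, rfl⟩ α i
      exact ⟨i, α * β, fun s => by simp [add_comm]⟩
    · intro h
      obtain ⟨⟨u, v⟩, β, hy⟩ := h 1 0
      replace hy : ∀ s t, y (s, t) = u ⬝ᵥ ρ v s + v ⬝ᵥ t + β := by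
        intro s t
        simpa [mmMatrix] using hy (s, t)
      have key : ∀ u' v', ∃ u'', ∀ s, u ⬝ᵥ ρ v s + u' ⬝ᵥ ρ v' s = u'' ⬝ᵥ ρ (v + v') s := by
        intro u' v'
        obtain ⟨⟨u'', v''⟩, β', hj⟩ := h 1 (u', v')
        replace hj : ∀ s t, u ⬝ᵥ ρ v s + v ⬝ᵥ t + β + (u' ⬝ᵥ ρ v' s + v' ⬝ᵥ t) =
            u'' ⬝ᵥ ρ v'' s + v'' ⬝ᵥ t + β' := by
          intro s t
          simpa [mmMatrix, hy] using hj (s, t)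
        have hβ : β = β' := by simpa [hρ0] using hj 0 0
        subst hβ
        have hv'' : v'' = v + v' := by
          ext i
          have := hj 0 (Pi.single i 1)
          simp [hρ0] at this
          simp only [Pi.add_apply]
          linear_combination -this
        subst hv''
        refine ⟨u'', fun s => ?_⟩
        have := hj s 0
        simp at this
        linear_combination this
      have hone : (1 : Fin (b + 1) → F) ≠ 0 := one_ne_zero
      have hua : (1 : Fin a → F) ≠ 0 := fun h => by
        simpa using congrFun h ⟨0, Nat.pos_of_ne_zero ha⟩
      have hv : v = 0 := by
        by_contra hv0
        by_cases hv1 : v = 1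
        · subst hv1
          -- The choice `1 - u` makes the left side `1 ⬝ ρ₀ s`, while the right side is linear
          -- because `1 + 1 ≠ 1`.
          obtain ⟨u'', hu⟩ := key (1 - u) 1
          rw [hρ' (1 + 1) (by simp), hρ1] at hu
          have := hlin u'' 1 fun s => by
            have := hu s
            rw [sub_dotProduct] at this
            simp only [Equiv.Perm.one_apply] at this
            linear_combination -this
          subst this
          obtain ⟨s, hs⟩ := exists_dotProduct_eq_one hua
          have := hu (ρ₀.symm s)
          rw [sub_dotProduct] at this
          simp [hs] at this
        · obtain ⟨u'', hu⟩ := key 1 1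
          rw [hρ' (v + 1) (by simpa using hv0), hρ1, hρ' v hv1] at hu
          have := hlin (u'' - u) 1 fun s => by
            have := hu s
            rw [sub_dotProduct]
            simp only [Equiv.Perm.one_apply] at this
            linear_combination -this
          rw [sub_eq_zero] at this
          subst this
          obtain ⟨s, hs⟩ := exists_dotProduct_eq_one hua
          have := hu (ρ₀.symm s)
          simp [hs] at this
      subst hv
      have hu0 : u = 0 := by
        obtain ⟨u'', hu⟩ := key 0 1
        rw [zero_add, hρ1, hρ' 0 hone.symm] at hu
        exact hlin u u'' fun s => by simpa using hu s
      subst hu0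
      refine ⟨β, ?_⟩
      ext ⟨s, t⟩
      simp [hy]

/-- On a field with at least four elements, some permutation fixing `0` is not a scaling. -/
theorem exists_perm_of_four_le_card {F : Type*} [Field F] [Fintype F] (hq : 3 < Fintype.card F) :
    ∃ ρ : Equiv.Perm (Fin 1 → F), ρ 0 = 0 ∧
      ∀ u w : Fin 1 → F, (∀ s, u ⬝ᵥ s = w ⬝ᵥ ρ s) → u = 0 := by
  classical
  obtain ⟨x, hx0, hx1⟩ := exists_ne_zero_ne_one (F := F) (by omega)
  obtain ⟨y, hy⟩ := Finset.exists_mem_notMem_of_card_lt_card (s := {0, 1, x}) (t := Finset.univ)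
    (lt_of_le_of_lt (Finset.card_le_three (a := (0 : F)) (b := 1) (c := x)) (by simpa using hq))
  simp only [Finset.mem_univ, Finset.mem_insert, Finset.mem_singleton, not_or, true_and] at hy
  obtain ⟨hy0, hy1, hyx⟩ := hy
  have hne : ∀ {c d : F}, c ≠ d → (fun _ : Fin 1 => c) ≠ fun _ => d := fun h e => h (congrFun e 0)
  refine ⟨Equiv.swap (fun _ => 1) (fun _ => x),
    Equiv.swap_apply_of_ne_of_ne (hne zero_ne_one) (hne hx0.symm), fun u w h => ?_⟩
  -- The fixed point `y` forces `u = w`, whereas the moved point `1` forces `u = x * w`.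
  have h1 := h fun _ => 1
  have h2 := h fun _ => y
  rw [Equiv.swap_apply_left] at h1
  rw [Equiv.swap_apply_of_ne_of_ne (hne hy1) (hne hyx)] at h2
  simp [dotProduct] at h1 h2
  have h3 := h2.resolve_right hy0
  have h4 : u 0 * (x - 1) = 0 := by
    rw [← h3] at h1
    linear_combination -h1
  ext i
  rw [Fin.fin_one_eq_zero i]
  exact (mul_eq_zero.1 h4).resolve_right (sub_ne_zero.2 hx1)

/-- The quadratic permutation `(x, y) ↦ (x + y², y + (x + y²)²)` has no linear component. -/
theorem exists_perm_of_two_ne_zero {F : Type*} [Field F] (h2 : (2 : F) ≠ 0) :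
    ∃ ρ : Equiv.Perm (Fin 2 → F), ρ 0 = 0 ∧
      ∀ u w : Fin 2 → F, (∀ s, u ⬝ᵥ s = w ⬝ᵥ ρ s) → u = 0 := by
  let ρ : Equiv.Perm (Fin 2 → F) :=
    { toFun := fun s => ![s 0 + s 1 ^ 2, s 1 + (s 0 + s 1 ^ 2) ^ 2]
      invFun := fun s => ![s 0 - (s 1 - s 0 ^ 2) ^ 2, s 1 - s 0 ^ 2]
      left_inv := fun s => by ext i; fin_cases i <;> simp
      right_inv := fun s => by ext i; fin_cases i <;> simp }
  have hρ : ∀ s, ρ s = ![s 0 + s 1 ^ 2, s 1 + (s 0 + s 1 ^ 2) ^ 2] := fun s => rfl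
  refine ⟨ρ, by ext i; fin_cases i <;> simp [hρ], fun u w h => ?_⟩
  have h' : ∀ x y, u 0 * x + u 1 * y = w 0 * (x + y ^ 2) + w 1 * (y + (x + y ^ 2) ^ 2) := by
    intro x y
    simpa [hρ, dotProduct, Fin.sum_univ_two] using h ![x, y]
  -- Adding the identities at opposite points cancels the odd terms.
  have hw1 : w 1 = 0 := by
    refine (mul_eq_zero.1 (?_ : 2 * w 1 = 0)).resolve_left h2
    linear_combination -h' 1 0 - h' (-1) 0
  have hw0 : w 0 = 0 := by
    refine (mul_eq_zero.1 (?_ : 2 * w 0 = 0)).resolve_left h2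
    linear_combination -h' 0 1 - h' 0 (-1) - 2 * hw1
  ext i
  fin_cases i
  · have := h' 1 0
    simpa [hw0, hw1] using this
  · have := h' 0 1
    simpa [hw0, hw1] using this

/-! ### Kernel dimensions realized in each length -/

theorem exists_kerDim_eq {F : Type*} [Field F] [Fintype F] (hq : 2 < Fintype.card F) {n h k : ℕ}
    (hn : n = Fintype.card F ^ h) (hk : 2 ≤ k) (hkh : k ≤ h + 1) :
    ∃ C : Set (Fin n → F), IsGHCode C ∧ kerDim C = k := by
  obtain ⟨a, rfl⟩ := Nat.exists_eq_add_of_le hk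
  obtain ⟨b, rfl⟩ : ∃ b, h = a + 1 + b := ⟨h - (a + 1), by omega⟩
  rw [show 2 + a = a + 1 + 1 by omega]
  exact exists_kerDim_eq_succ hq hn

theorem exists_kerDim_one {F : Type*} [Field F] [Fintype F] (hq : 2 < Fintype.card F) {n h : ℕ}
    (hn : n = Fintype.card F ^ h) (hh : 2 ≤ h) (hqh : ¬ (Fintype.card F = 3 ∧ h = 2)) :
    ∃ C : Set (Fin n → F), IsGHCode C ∧ kerDim C = 1 := by
  by_cases h3 : Fintype.card F = 3
  · have h2 : (2 : F) ≠ 0 := by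
      intro h2
      have h0 : ((Fintype.card F : ℕ) : F) = 0 := Nat.cast_card_eq_zero F
      rw [h3] at h0
      push_cast at h0
      exact one_ne_zero (α := F) (by linear_combination h0 - h2)
    -- Two coordinates for `ρ` and at least one for `t` require `h ≥ 3`, which holds since `(3, 2)`
    -- is excluded.
    obtain ⟨b, rfl⟩ : ∃ b, h = 2 + (b + 1) := ⟨h - 3, by omega⟩
    obtain ⟨ρ, hρ, hlin⟩ := exists_perm_of_two_ne_zero h2
    exact exists_kerDim_eq_one hq hn ρ hρ hlin two_ne_zero
  · obtain ⟨b, rfl⟩ : ∃ b, h = 1 + (b + 1) := ⟨h - 2, by omega⟩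
    obtain ⟨ρ, hρ, hlin⟩ := exists_perm_of_four_le_card (F := F) (by omega)
    exact exists_kerDim_eq_one hq hn ρ hρ hlin one_ne_zero

/-! ### Balanced functions with values in `ZMod 3` -/

/-- Every value of `f` is taken exactly three times. -/
def IsTriplyBalanced {ι : Type*} [Fintype ι] (f : ι → ZMod 3) : Prop :=
  ∀ c, (Finset.univ.filter fun s => f s = c).card = 3

theorem sum_zmod_three {M : Type*} [AddCommMonoid M] (f : ZMod 3 → M) :
    ∑ c, f c = f 0 + f 1 + f 2 :=
  Fin.sum_univ_three f

theorem zmod_three_cases (c : ZMod 3) : c = 0 ∨ c = 1 ∨ c = 2 := by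
  revert c
  decide

theorem card_filter_eq_sum {ι : Type*} [Fintype ι] (x y : ι → ZMod 3) (P : ι → Prop)
    [DecidablePred P] (φ : ZMod 3 → ZMod 3) (h : ∀ s, P s ↔ x s = φ (y s)) :
    (Finset.univ.filter P).card =
      ∑ b, (Finset.univ.filter fun s => x s = φ b ∧ y s = b).card := by
  rw [Finset.card_eq_sum_card_fiberwise (f := y) (t := Finset.univ) (by simp)]
  refine Finset.sum_congr rfl fun b _ => ?_
  rw [Finset.filter_filter]
  congr 1
  ext s
  simp only [Finset.mem_filter, Finset.mem_univ, true_and, h]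
  constructor <;> rintro ⟨h1, rfl⟩ <;> exact ⟨h1, rfl⟩

/-- The joint distribution of two balanced functions with balanced difference. -/
theorem IsTriplyBalanced.exists_joint {ι : Type*} [Fintype ι] {x y : ι → ZMod 3}
    (hx : IsTriplyBalanced x) (hy : IsTriplyBalanced y)
    (hxy : IsTriplyBalanced fun s => x s - y s) :
    ∃ N : ZMod 3 → ZMod 3 → ℕ,
      (∀ a b, (Finset.univ.filter fun s => x s = a ∧ y s = b).card = N a b) ∧
      (∀ c, (Finset.univ.filter fun s => x s + y s = c).card = N (c - 0) 0 + N (c - 1) 1 + N (c - 2) 2) ∧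
      (∀ a, N a 0 + N a 1 + N a 2 = 3) ∧ (∀ b, N 0 b + N 1 b + N 2 b = 3) ∧
      ∀ c, N (c + 0) 0 + N (c + 1) 1 + N (c + 2) 2 = 3 := by
  refine ⟨fun a b => (Finset.univ.filter fun s => x s = a ∧ y s = b).card, fun _ _ => rfl,
    fun c => ?_, fun a => ?_, fun b => ?_, fun c => ?_⟩
  · rw [card_filter_eq_sum x y _ (fun b => c - b) fun s => eq_sub_iff_add_eq.symm, sum_zmod_three]
  · refine Eq.trans ?_ (hx a)
    rw [card_filter_eq_sum x y _ (fun _ => a) fun s => Iff.rfl, sum_zmod_three]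
  · refine Eq.trans ?_ (hy b)
    rw [card_filter_eq_sum y x _ (fun _ => b) fun s => Iff.rfl, sum_zmod_three]
    simp only [and_comm]
  · refine Eq.trans ?_ (hxy c)
    rw [card_filter_eq_sum x y _ (fun b => c + b) fun s => sub_eq_iff_eq_add, sum_zmod_three]

/-- View `N` as a weight of total 9 on the affine plane of order 3. The four lines through a point
`P` have total weight `9 + 3 * N P`; three of them weigh 3 each, so the fourth weighs `3 * N P`. -/
theorem IsTriplyBalanced.three_dvd_card {ι : Type*} [Fintype ι] {x y : ι → ZMod 3}
    (hx : IsTriplyBalanced x) (hy : IsTriplyBalanced y)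
    (hxy : IsTriplyBalanced fun s => x s - y s) (c : ZMod 3) :
    3 ∣ (Finset.univ.filter fun s => x s + y s = c).card := by
  obtain ⟨N, -, h4, h1, h2, h3⟩ := hx.exists_joint hy hxy
  have a0 := h1 0
  have a1 := h1 1
  have a2 := h1 2
  have b0 := h2 0
  have b1 := h2 1
  have b2 := h2 2
  have c0 : N 0 0 + N 1 1 + N 2 2 = 3 := h3 0
  have c1 : N 1 0 + N 2 1 + N 0 2 = 3 := h3 1
  have c2 : N 2 0 + N 0 1 + N 1 2 = 3 := h3 2
  rw [h4]
  obtain rfl | rfl | rfl := zmod_three_cases c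
  · change 3 ∣ N 0 0 + N 2 1 + N 1 2
    omega
  · change 3 ∣ N 1 0 + N 0 1 + N 2 2
    omega
  · change 3 ∣ N 2 0 + N 1 1 + N 0 2
    omega

/-- By the same count of lines through a point, all four lines now weigh 3, so `12 = 9 + 3 * N P`.
-/
theorem IsTriplyBalanced.card_eq_one {ι : Type*} [Fintype ι] {x y : ι → ZMod 3}
    (hx : IsTriplyBalanced x) (hy : IsTriplyBalanced y)
    (hxy : IsTriplyBalanced fun s => x s - y s) (hxy' : IsTriplyBalanced fun s => x s + y s)
    (a b : ZMod 3) : (Finset.univ.filter fun s => x s = a ∧ y s = b).card = 1 := by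
  obtain ⟨N, hN, h4, h1, h2, h3⟩ := hx.exists_joint hy hxy
  have a0 := h1 0
  have a1 := h1 1
  have a2 := h1 2
  have b0 := h2 0
  have b1 := h2 1
  have b2 := h2 2
  have c0 : N 0 0 + N 1 1 + N 2 2 = 3 := h3 0
  have c1 : N 1 0 + N 2 1 + N 0 2 = 3 := h3 1
  have c2 : N 2 0 + N 0 1 + N 1 2 = 3 := h3 2
  have d0 : N 0 0 + N 2 1 + N 1 2 = 3 := (h4 0).symm.trans (hxy' 0)
  have d1 : N 1 0 + N 0 1 + N 2 2 = 3 := (h4 1).symm.trans (hxy' 1)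
  have d2 : N 2 0 + N 1 1 + N 0 2 = 3 := (h4 2).symm.trans (hxy' 2)
  rw [hN]
  obtain rfl | rfl | rfl := zmod_three_cases a <;> obtain rfl | rfl | rfl := zmod_three_cases b <;>
    omega

theorem IsTriplyBalanced.injective_of_comp {ι : Type*} [Fintype ι] {r : ι → ZMod 3}
    (hr : IsTriplyBalanced r) {f : ZMod 3 → ZMod 3} (hf : IsTriplyBalanced fun s => f (r s)) :
    Function.Injective f := by
  classical
  intro y z hyz
  by_contra hne
  have hdisj : Disjoint (Finset.univ.filter fun s => r s = y) (Finset.univ.filter fun s => r s = z) :=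
    Finset.disjoint_filter.2 fun s _ h1 h2 => hne (h1.symm.trans h2)
  have hsub : (Finset.univ.filter fun s => r s = y) ∪ (Finset.univ.filter fun s => r s = z) ⊆
      Finset.univ.filter fun s => f (r s) = f z := by
    intro s hs
    simp only [Finset.mem_union, Finset.mem_filter, Finset.mem_univ, true_and] at hs ⊢
    rcases hs with h | h <;> simp [h, hyz]
  have := Finset.card_le_card hsub
  rw [Finset.card_union_of_disjoint hdisj, hr, hr, hf] at this
  omega

/-- The columns of a generalized Hadamard matrix of order nine over `ZMod 3` are balanced too. -/
theorem isTriplyBalanced_columns {ι : Type*} [Fintype ι] (hι : Fintype.card ι = 9)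
    {h : ι → ι → ZMod 3} (hb : ∀ i j, i ≠ j → IsTriplyBalanced fun s => h i s - h j s)
    {s t : ι} (hst : s ≠ t) : IsTriplyBalanced fun j => h j s - h j t := by
  classical
  obtain ⟨ζ, hζ⟩ : ∃ ζ : ℂ, IsPrimitiveRoot ζ 3 := ⟨_, Complex.isPrimitiveRoot_exp 3 (by norm_num)⟩
  have hz3 : ζ ^ 3 = 1 := hζ.pow_eq_one
  have hz1 : ζ ≠ 1 := hζ.ne_one (by norm_num)
  have hz : 1 + ζ + ζ ^ 2 = 0 := by
    have : (ζ - 1) * (1 + ζ + ζ ^ 2) = 0 := by linear_combination hz3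
    exact (mul_eq_zero.1 this).resolve_left (sub_ne_zero.2 hz1)
  let χ : ZMod 3 → ℂ := fun x => ζ ^ x.val
  have hχ : ∀ x y, χ (x - y) = χ x * χ (-y) := by
    intro x y
    simp only [χ]
    rw [sub_eq_add_neg, ZMod.val_add, ← pow_eq_pow_mod _ hz3, pow_add]
  have hχ0 : χ 0 = 1 := by simp [χ]
  have hsum : ∀ f : ι → ZMod 3, ∑ s, χ (f s) =
      ∑ c, ((Finset.univ.filter fun s => f s = c).card : ℂ) * χ c := by
    intro f
    rw [← Finset.sum_fiberwise Finset.univ f]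
    refine Finset.sum_congr rfl fun c _ => ?_
    rw [Finset.sum_congr rfl (g := fun _ => χ c) (by simp +contextual)]
    simp
  -- Row balance makes the character matrix a multiple of a unitary one; a right inverse is a left
  -- inverse, so the columns are orthogonal too.
  let M : Matrix ι ι ℂ := fun i s => χ (h i s)
  let M' : Matrix ι ι ℂ := fun s i => χ (-h i s)
  have hMM : M * ((1 / 9 : ℂ) • M') = 1 := by
    ext i j
    rw [Matrix.mul_smul, Matrix.smul_apply, Matrix.mul_apply]
    simp only [M, M', ← hχ]
    by_cases hij : i = j
    · subst hij
      simp [hχ0, hι]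
    · rw [hsum, Matrix.one_apply_ne hij]
      simp only [hb i j hij _, sum_zmod_three]
      simp only [χ]
      have : (2 : ZMod 3).val = 2 := rfl
      rw [this, ZMod.val_zero, ZMod.val_one]
      simp only [smul_eq_mul]
      push_cast
      linear_combination (1 / 3) * hz
  have hMM' := mul_eq_one_comm.1 hMM
  have h0 : ∑ j, χ (h j s - h j t) = 0 := by
    have := congrFun (congrFun hMM' t) s
    rw [Matrix.smul_mul, Matrix.smul_apply, Matrix.mul_apply, Matrix.one_apply_ne hst.symm] at this
    simp only [M, M', smul_eq_mul] at this
    have h9 := (mul_eq_zero.1 this).resolve_left (by norm_num)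
    rw [← h9]
    exact Finset.sum_congr rfl fun j _ => by rw [hχ, mul_comm]
  have hcard : ∑ c, (Finset.univ.filter fun j => h j s - h j t = c).card = 9 := by
    rw [← hι, ← Finset.card_univ]
    exact (Finset.card_eq_sum_card_fiberwise (by simp)).symm
  rw [hsum] at h0
  unfold IsTriplyBalanced
  generalize hN : (fun c => (Finset.univ.filter fun j => h j s - h j t = c).card) = N
  have hN' : ∀ c, (Finset.univ.filter fun j => h j s - h j t = c).card = N c :=
    fun c => by rw [← hN]
  simp only [hN', sum_zmod_three] at h0 hcard ⊢
  simp only [χ] at h0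
  have : (2 : ZMod 3).val = 2 := rfl
  rw [this, ZMod.val_zero, ZMod.val_one] at h0
  -- Since `ζ` is not real, `1` and `ζ` are independent over `ℝ`, so the three counts agree.
  have h1 : ((N 0 : ℝ) - N 2 : ℝ) + ((N 1 : ℝ) - N 2 : ℝ) * ζ = 0 := by
    push_cast
    linear_combination h0 - N 2 * hz
  have him : ζ.im ≠ 0 := by
    intro him
    have hre : (ζ.re : ℂ) = ζ := Complex.ext (by simp) (by simp [him])
    rw [← hre] at hz
    have : 1 + ζ.re + ζ.re ^ 2 = 0 := by exact_mod_cast hz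
    nlinarith [sq_nonneg (ζ.re + 1 / 2)]
  have h12 : (N 1 : ℝ) = N 2 := by
    have := congrArg Complex.im h1
    simp [him] at this
    linarith
  have h02 : (N 0 : ℝ) = N 2 := by
    have := congrArg Complex.re h1
    simp [h12] at this
    linarith
  have h12' : N 1 = N 2 := by exact_mod_cast h12
  have h02' : N 0 = N 2 := by exact_mod_cast h02
  intro c
  obtain rfl | rfl | rfl := zmod_three_cases c <;> omega

/-! ### Lines of rows in generalized Hadamard matrices of order nine -/

/-- The function on `ZMod 3` with values `a`, `b`, `c`. -/
def tripleFun (a b c : ℤ) : ZMod 3 → ℤ := ![a, b, c]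

/-- The base pattern `(1, -1, 0)`. -/
def signPattern : ZMod 3 → ℤ := tripleFun 1 (-1) 0

/-- A finite check. A sum of the form `(2, -1, -1)` forces equal signs, two equal shifts and a third
determined by them; moving all three shifts together changes their sum by a multiple of 3. -/
theorem signPattern_sum (ε₁ ε₂ ε₃ : ℤˣ) (x y z p : ZMod 3)
    (h : ∀ c, ε₁ * signPattern (c + x) + ε₂ * signPattern (c + y) + ε₃ * signPattern (c + z) =
      if p = c then 2 else -1) :
    x + y + z = if ε₁ = 1 then 2 else 1 := by
  revert ε₁ ε₂ ε₃ x y z p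
  decide +kernel

theorem exists_signPattern (m : ZMod 3 → ℤ) (hm : ∀ c, -1 ≤ m c) (hsum : m 0 + m 1 + m 2 = 0) :
    (∑ c, m c ^ 2 = 0 ∧ ∀ c, m c = 0) ∨
    (∑ c, m c ^ 2 = 2 ∧ ∃ (ε : ℤˣ) (k : ZMod 3), ∀ c, m c = ε * signPattern (c + k)) ∨
    (∑ c, m c ^ 2 = 6 ∧ ∃ c, m c = 2) := by
  have h0 := hm 0
  have h1 := hm 1
  have h2 := hm 2
  have key : ∀ a b c : ℤ, m 0 = a → m 1 = b → m 2 = c → m = tripleFun a b c := by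
    intro a b c ha hb hc
    ext i
    fin_cases i <;> assumption
  have u0 : m 0 ≤ 2 := by omega
  have u1 : m 1 ≤ 2 := by omega
  obtain ⟨a, ha⟩ : ∃ a, m 0 = a := ⟨_, rfl⟩
  obtain ⟨b, hb⟩ : ∃ b, m 1 = b := ⟨_, rfl⟩
  obtain ⟨c, hc⟩ : ∃ c, m 2 = c := ⟨_, rfl⟩
  have hmm := key a b c ha hb hc
  have hc' : c = -a - b := by omega
  rw [ha] at h0 u0
  rw [hb] at h1 u1
  rw [hc, hc'] at h2
  subst hmm hc'
  clear key ha hb hc hm hsum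
  interval_cases a <;> interval_cases b <;> first | omega | decide

/-- A GH matrix of order nine over `ZMod 3` with a zero row has three distinct rows whose sum is
constant. -/
theorem exists_rows_sum_const_of_zero_row {ι : Type*} [Fintype ι] (hι : Fintype.card ι = 9)
    {h : ι → ι → ZMod 3} (hb : ∀ i j, i ≠ j → IsTriplyBalanced fun s => h i s - h j s)
    {i₀ : ι} (h₀ : ∀ s, h i₀ s = 0) :
    ∃ a b d : ι, a ≠ b ∧ a ≠ d ∧ b ≠ d ∧ ∃ κ, ∀ s, h a s + h b s + h d s = κ := by
  classical
  have : Nontrivial ι := Fintype.one_lt_card_iff_nontrivial.1 (by omega)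
  obtain ⟨i, hi⟩ := exists_ne i₀
  have hib : IsTriplyBalanced (h i) := by simpa [h₀] using hb i i₀ hi
  have hneg : IsTriplyBalanced fun s => h i s + h i s := by
    have := hb i₀ i hi.symm
    simp only [h₀, zero_sub] at this
    convert this using 2 with s
    generalize h i s = x
    revert x
    decide
  have hdvd : ∀ j c, 3 ∣ (Finset.univ.filter fun t => h i t + h j t = c).card := by
    intro j c
    by_cases hj₀ : j = i₀
    · subst hj₀
      simp only [h₀, add_zero]
      rw [hib c]
    by_cases hji : j = i
    · subst hji
      rw [hneg c]
    have hjb : IsTriplyBalanced (h j) := by simpa [h₀] using hb j i₀ hj₀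
    exact hib.three_dvd_card hjb (hb i j (Ne.symm hji)) c
  choose g hg using hdvd
  let m : ι → ZMod 3 → ℤ := fun j c => g j c - 1
  have hm : ∀ j c, ((Finset.univ.filter fun t => h i t + h j t = c).card : ℤ) = 3 * (m j c + 1) := by
    intro j c
    rw [hg]
    simp [m]
  have hm1 : ∀ j c, -1 ≤ m j c := by
    intro j c
    simp only [m]
    omega
  have hmsum : ∀ j, m j 0 + m j 1 + m j 2 = 0 := by
    intro j
    have h1 : Fintype.card ι = ∑ c, (Finset.univ.filter fun t => h i t + h j t = c).card := by
      rw [← Finset.card_univ]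
      exact Finset.card_eq_sum_card_fiberwise (by simp)
    rw [hι, sum_zmod_three] at h1
    have h2 := hm j 0
    have h3 := hm j 1
    have h4 := hm j 2
    omega
  -- the columns are balanced
  have hcol : ∀ s c, ∑ j, m j (c + h j s) = if h i s = c then 2 else -1 := by
    intro s c
    -- Double counting of the pairs `(j, t)`: each column `t ≠ s` contributes 3, and `t = s`
    -- contributes 9 or 0.
    have e1 : ∑ j, ((Finset.univ.filter fun t => h i t + h j t = c + h j s).card : ℤ) =
        ∑ t, ((Finset.univ.filter fun j => h j t - h j s = c - h i t).card : ℤ) := by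
      simp only [Finset.card_filter]
      push_cast
      rw [Finset.sum_comm]
      refine Finset.sum_congr rfl fun t _ => Finset.sum_congr rfl fun j _ => ?_
      congr 1
      rw [sub_eq_sub_iff_add_eq_add, add_comm (h j t)]
    have e2 : ∀ t, ((Finset.univ.filter fun j => h j t - h j s = c - h i t).card : ℤ) =
        3 + if t = s then (if h i s = c then 6 else -3) else 0 := by
      intro t
      by_cases hts : t = s
      · subst hts
        by_cases hc : h i t = c
        · simp [hc, hι]
        · simp [hc, sub_eq_zero, eq_comm (a := (0 : ZMod 3)), Ne.symm hc]
      · simp only [isTriplyBalanced_columns hι hb hts _, hts, if_false]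
        simp
    rw [Finset.sum_congr rfl fun t _ => e2 t, Finset.sum_congr rfl fun j _ => hm j _,
      Finset.sum_add_distrib, ← Finset.mul_sum, Finset.sum_add_distrib] at e1
    simp only [Finset.sum_const, Finset.card_univ, hι, Finset.sum_ite_eq', Finset.mem_univ,
      if_true] at e1
    split_ifs at e1 ⊢ <;> norm_num at e1 <;> omega
  -- Put `c = h i s` and sum over `s`. For fixed `j` the value `c` occurs `3 * (m j c + 1)` times,
  -- and the linear part vanishes because `m j` sums to zero.
  have hsq : ∑ j, ∑ c, m j c ^ 2 = 6 := by
    have e1 : ∑ s, ∑ j, m j (h i s + h j s) = 18 := by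
      rw [Finset.sum_congr rfl fun s _ => hcol s (h i s)]
      simp [hι]
    have e2 : ∀ j, ∑ s, m j (h i s + h j s) = 3 * ∑ c, m j c ^ 2 := by
      intro j
      rw [← Finset.sum_fiberwise Finset.univ (fun s => h i s + h j s)]
      have : ∀ c, ∑ s ∈ Finset.univ.filter (fun s => h i s + h j s = c), m j (h i s + h j s) =
          3 * (m j c + 1) * m j c := by
        intro c
        rw [Finset.sum_congr rfl (g := fun _ => m j c) (by simp +contextual)]
        rw [Finset.sum_const, nsmul_eq_mul, hm]
      simp only [this, sum_zmod_three]
      linear_combination 3 * hmsum j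
    rw [Finset.sum_comm, Finset.sum_congr rfl fun j _ => e2 j, ← Finset.mul_sum] at e1
    omega
  -- If `m j c = 2`, then rows `i` and `j` sum to `c` in all nine columns, and the zero row
  -- completes the triple. Otherwise each row contributes 0 or 2 to the total 6, so exactly three
  -- rows have `m j ≠ 0`.
  by_cases h6 : ∃ j c, m j c = 2
  · obtain ⟨j, c, hjc⟩ := h6
    have hall : ∀ t, h i t + h j t = c := by
      have h9 := hm j c
      rw [hjc] at h9
      have h9' : (Finset.univ.filter fun t => h i t + h j t = c).card = Fintype.card ι := by
        rw [hι]; omega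
      rw [Finset.card_eq_iff_eq_univ] at h9'
      intro t
      have := Finset.mem_univ t
      rw [← h9'] at this
      simpa using this
    have hj : j ≠ i₀ := by
      rintro rfl
      have := hm j c
      simp only [h₀, add_zero] at this
      rw [hib c, hjc] at this
      norm_num at this
    have hji : i ≠ j := by
      rintro rfl
      have := hm i c
      rw [hneg c, hjc] at this
      norm_num at this
    exact ⟨i₀, i, j, hi.symm, hj.symm, hji, c, fun s => by rw [h₀, zero_add, hall]⟩
  · push Not at h6
    have hcl : ∀ j, (∑ c, m j c ^ 2 = 0 ∧ ∀ c, m j c = 0) ∨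
        (∑ c, m j c ^ 2 = 2 ∧ ∃ (ε : ℤˣ) (k : ZMod 3), ∀ c, m j c = ε * signPattern (c + k)) := by
      intro j
      rcases exists_signPattern (m j) (hm1 j) (hmsum j) with h | h | ⟨-, c, h⟩
      · exact Or.inl h
      · exact Or.inr h
      · exact absurd h (h6 j c)
    have hS : (Finset.univ.filter fun j => ∑ c, m j c ^ 2 = 2).card = 3 := by
      have : ∀ j, ∑ c, m j c ^ 2 = if ∑ c, m j c ^ 2 = 2 then 2 else 0 := by
        intro j
        rcases hcl j with h | h <;> simp [h.1]
      rw [Finset.sum_congr rfl fun j _ => this j, ← Finset.sum_filter, Finset.sum_const] at hsq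
      simp only [nsmul_eq_mul] at hsq
      omega
    obtain ⟨a, b, d, hab, had, hbd, hS⟩ := Finset.card_eq_three.1 hS
    have hout : ∀ j, j ∉ ({a, b, d} : Finset ι) → ∀ c, m j c = 0 := by
      intro j hj
      rw [← hS] at hj
      rcases hcl j with h | h
      · exact h.2
      · simp [h.1] at hj
    have hin : ∀ j, j ∈ ({a, b, d} : Finset ι) →
        ∃ (ε : ℤˣ) (k : ZMod 3), ∀ c, m j c = ε * signPattern (c + k) := by
      intro j hj
      rw [← hS] at hj
      rcases hcl j with h | h
      · simp [h.1] at hj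
      · exact h.2
    obtain ⟨ε₁, k₁, e₁⟩ := hin a (by simp)
    obtain ⟨ε₂, k₂, e₂⟩ := hin b (by simp)
    obtain ⟨ε₃, k₃, e₃⟩ := hin d (by simp)
    refine ⟨a, b, d, hab, had, hbd, (if ε₁ = 1 then 2 else 1) - (k₁ + k₂ + k₃), fun s => ?_⟩
    rw [← signPattern_sum ε₁ ε₂ ε₃ (h a s + k₁) (h b s + k₂) (h d s + k₃) (h i s) fun c => ?_]
    · ring
    · rw [← hcol s c, ← Finset.sum_subset (Finset.subset_univ {a, b, d}) fun j _ hj => hout j hj _]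
      rw [Finset.sum_insert (by simp [hab, had]), Finset.sum_insert (by simp [hbd]),
        Finset.sum_singleton, e₁, e₂, e₃]
      simp only [add_assoc]

theorem exists_rows_sum_const {ι : Type*} [Fintype ι] (hι : Fintype.card ι = 9)
    {h : ι → ι → ZMod 3} (hb : ∀ i j, i ≠ j → IsTriplyBalanced fun s => h i s - h j s) (i₀ : ι) :
    ∃ a b d : ι, a ≠ b ∧ a ≠ d ∧ b ≠ d ∧ ∃ κ, ∀ s, h a s + h b s + h d s = κ := by
  obtain ⟨a, b, d, hab, had, hbd, κ, hκ⟩ := exists_rows_sum_const_of_zero_row hι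
    (h := fun i s => h i s - h i₀ s) (fun i j hij => by simpa using hb i j hij) (i₀ := i₀) (by simp)
  refine ⟨a, b, d, hab, had, hbd, κ, fun s => ?_⟩
  have h3 : (3 : ZMod 3) = 0 := rfl
  linear_combination hκ s + h i₀ s * h3

/-! ### From three rows with constant sum to a kernel vector -/

theorem IsTriplyBalanced.of_eq_const_add {ι : Type*} [Fintype ι] {f g : ι → ZMod 3}
    (hf : IsTriplyBalanced f) (κ : ZMod 3) (h : ∀ s, g s = κ + f s) : IsTriplyBalanced g := by
  intro c
  refine Eq.trans ?_ (hf (c - κ))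
  congr 1
  ext s
  simp only [Finset.mem_filter, Finset.mem_univ, true_and, h, eq_sub_iff_add_eq, add_comm]

theorem exists_affine_of_injective (f : ZMod 3 → ZMod 3) (hf : Function.Injective f) :
    ∃ ε e : ZMod 3, ε ≠ 0 ∧ ∀ x, f x = ε * x + e := by
  have h01 : f 0 ≠ f 1 := fun h => absurd (hf h) (by decide)
  have h02 : f 0 ≠ f 2 := fun h => absurd (hf h) (by decide)
  have h12 : f 1 ≠ f 2 := fun h => absurd (hf h) (by decide)
  have key : ∀ a b c : ZMod 3, a ≠ b → a ≠ c → b ≠ c → c = (b - a) * 2 + a := by decide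
  refine ⟨f 1 - f 0, f 0, sub_ne_zero.2 h01.symm, fun x => ?_⟩
  obtain rfl | rfl | rfl := zmod_three_cases x
  · ring
  · ring
  · exact key _ _ _ h01 h02 h12

/-- If the sum of three distinct rows `a`, `b`, `d` is constant, then translation by the difference
of the rows `b` and `a` permutes the rows up to constants. -/
theorem exists_row_add_eq {ι : Type*} [Fintype ι] (hι : Fintype.card ι = 9)
    {h : ι → ι → ZMod 3} (hb : ∀ i j, i ≠ j → IsTriplyBalanced fun s => h i s - h j s)
    {a b d : ι} (hab : a ≠ b) (had : a ≠ d) (hbd : b ≠ d) {κ : ZMod 3}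
    (hκ : ∀ s, h a s + h b s + h d s = κ) (i : ι) :
    ∃ j β, ∀ s, (h b s - h a s) + h i s = h j s + β := by
  classical
  have h3 : (3 : ZMod 3) = 0 := rfl
  let r : ι → ZMod 3 := fun s => h b s - h a s
  let k : ι → ι → ZMod 3 := fun j s => h j s - h a s
  have hr : IsTriplyBalanced r := hb b a hab.symm
  have hk : ∀ i j, i ≠ j → IsTriplyBalanced fun s => k i s - k j s := fun i j hij => by
    simpa [k] using hb i j hij
  -- Modulo 3, `k j - r` and `k j + r` are row `j` minus row `b` and row `j` minus row `d`, up to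
  -- constants; hence `(k j, r)` is a bijection onto the plane.
  have hjoint : ∀ j, j ∉ ({a, b, d} : Finset ι) → ∀ x y,
      (Finset.univ.filter fun s => k j s = x ∧ r s = y).card = 1 := by
    intro j hj
    simp only [Finset.mem_insert, Finset.mem_singleton, not_or] at hj
    obtain ⟨hja, hjb, hjd⟩ := hj
    refine IsTriplyBalanced.card_eq_one (hb j a hja) hr (by simpa [k, r] using hb j b hjb) ?_
    refine (hb j d hjd).of_eq_const_add κ fun s => ?_
    simp only [k, r]
    linear_combination hκ s - h a s * h3
  have hinj : ∀ j, j ∉ ({a, b, d} : Finset ι) → ∀ s t, k j s = k j t → r s = r t → s = t := by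
    intro j hj s t h1 h2
    exact Finset.card_le_one.1 (hjoint j hj (k j t) (r t)).le s (by simp [h1, h2]) t (by simp)
  obtain ⟨i₀, hi₀⟩ : ∃ i₀, i₀ ∉ ({a, b, d} : Finset ι) := by
    obtain ⟨i₀, -, hi₀⟩ := Finset.exists_mem_notMem_of_card_lt_card (s := {a, b, d}) (t := Finset.univ)
      (lt_of_le_of_lt Finset.card_le_three (by rw [Finset.card_univ, hι]; norm_num))
    exact ⟨i₀, hi₀⟩
  have hsurj : ∀ x y, ∃ s, k i₀ s = x ∧ r s = y := by
    intro x y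
    obtain ⟨s, hs⟩ := Finset.card_pos.1 (by rw [hjoint i₀ hi₀ x y]; norm_num)
    exact ⟨s, by simpa using hs⟩
  choose S hS1 hS2 using hsurj
  have hS : ∀ s, S (k i₀ s) (r s) = s := fun s => hinj i₀ hi₀ _ _ (hS1 _ _) (hS2 _ _)
  have hform : ∀ j, ∃ (σ : ZMod 3) (e : ZMod 3 → ZMod 3), ∀ s, k j s = σ * k i₀ s + e (r s) := by
    intro j
    by_cases hj : j ∈ ({a, b, d} : Finset ι)
    · simp only [Finset.mem_insert, Finset.mem_singleton] at hj
      rcases hj with rfl | rfl | rfl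
      · exact ⟨0, fun _ => 0, fun s => by simp [k]⟩
      · exact ⟨0, fun y => y, fun s => by simp [k, r]⟩
      · refine ⟨0, fun y => κ - y, fun s => ?_⟩
        simp only [k, r]
        linear_combination hκ s - h a s * h3
    have haff : ∀ y, ∃ ε e : ZMod 3, ε ≠ 0 ∧ ∀ x, k j (S x y) = ε * x + e := by
      intro y
      refine exists_affine_of_injective _ fun x x' hxx => ?_
      have := hinj j hj _ _ hxx (by rw [hS2, hS2])
      rw [← hS1 x y, ← hS1 x' y, this]
    choose ε e hε he using haff
    have hval : ∀ s, k j s = ε (r s) * k i₀ s + e (r s) := by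
      intro s
      rw [← he, hS]
    by_cases hall : ∃ y, ε y = 1
    · by_cases hji : j = i₀
      · exact ⟨1, fun _ => 0, fun s => by simp [hji]⟩
      obtain ⟨y, hy⟩ := hall
      have hone : ∀ z, ε z = 1 := by
        intro z
        by_contra hz
        have hyz : z ≠ y := fun hyz => hz (hyz ▸ hy)
        have hz2 : ε z = 2 := by
          have := hε z
          revert hz this
          generalize ε z = w
          revert w
          decide
        -- If slopes 1 and 2 both occurred, the difference would equal `e y` on the whole fibre `r =
        -- y` and once more on `r = z`: four times instead of three.
        have hsub : insert (S (e y - e z) z) (Finset.univ.filter fun s => r s = y) ⊆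
            Finset.univ.filter fun s => k j s - k i₀ s = e y := by
          intro s hs
          simp only [Finset.mem_insert, Finset.mem_filter, Finset.mem_univ, true_and] at hs ⊢
          rcases hs with rfl | hs
          · rw [he, hS1, hz2]
            ring
          · rw [hval, hs, hy]
            ring
        have := Finset.card_le_card hsub
        rw [Finset.card_insert_of_notMem (by simp [hS2, hyz]), hr y, hk j i₀ hji (e y)] at this
        omega
      exact ⟨1, e, fun s => by rw [hval, hone]⟩
    · push Not at hall
      refine ⟨2, e, fun s => ?_⟩
      rw [hval]
      congr 2
      have h0 := hε (r s)
      have h1 := hall (r s)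
      revert h0 h1
      generalize ε (r s) = w
      revert w
      decide
  choose σ e he using hform
  have hdiff : ∀ i j, i ≠ j → σ i = σ j → Function.Injective fun y => e i y - e j y := by
    intro i j hij hσ
    refine hr.injective_of_comp ?_
    convert hk i j hij using 2 with s
    rw [he i, he j, hσ]
    ring
  -- Rows with equal `σ` differ by a permutation of the values of `r`, so the increment of `e`
  -- separates them; nine rows then fill all nine pairs.
  have hbij : Function.Bijective fun j => (σ j, e j 2 - e j 1) := by
    rw [Fintype.bijective_iff_injective_and_card]
    refine ⟨fun i j hij => ?_, by simp [hι, ZMod.card]⟩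
    by_contra hne
    simp only [Prod.mk.injEq] at hij
    have : (2 : ZMod 3) = 1 := hdiff i j hne hij.1 (by
      change e i 2 - e j 2 = e i 1 - e j 1
      linear_combination hij.2)
    exact absurd this (by decide)
  -- Raising the increment by 1 makes `e j - e i` an affine function of slope 1, so rows `j` and `i`
  -- differ by `r` plus a constant.
  obtain ⟨j, hj⟩ := hbij.2 (σ i, e i 2 - e i 1 + 1)
  simp only [Prod.mk.injEq] at hj
  have hij : j ≠ i := by
    rintro rfl
    have := hj.2
    simp at this
  obtain ⟨c, β, -, hcβ⟩ := exists_affine_of_injective _ (hdiff j i hij hj.1)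
  have hc1 : c = 1 := by
    linear_combination hj.2 - hcβ 2 + hcβ 1
  refine ⟨j, -β, fun s => ?_⟩
  have e1 := he i s
  have e2 := he j s
  have e3 := hcβ (r s)
  rw [hj.1] at e2
  rw [hc1] at e3
  simp only [k] at e1 e2
  simp only [r] at e1 e2 e3
  linear_combination e1 - e2 - e3

/-- The difference of two rows of the triple is balanced, hence not a multiple of the all-one
vector. -/
theorem two_le_kerDim_of_card_eq_three {F : Type*} [Field F] [Fintype F] (hF : Fintype.card F = 3)
    {C : Set (Fin 9 → F)} (hC : IsGHCode C) : 2 ≤ kerDim C := by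
  classical
  obtain ⟨lam, H, hH, hn, rfl⟩ := hC
  have hlam : lam = 3 := by
    have := hH.order_eq
    rw [hF] at this
    omega
  subst hlam
  obtain ⟨φ⟩ : Nonempty (F ≃+* ZMod 3) := ⟨(ZMod.ringEquivOfPrime F Nat.prime_three hF).symm⟩
  let h : Fin 9 → Fin 9 → ZMod 3 := fun i s => φ (H i s)
  have hb' : ∀ i j, i < j → IsTriplyBalanced fun s => h i s - h j s := by
    intro i j hij c
    refine Eq.trans ?_ (hH.balanced i j hij (φ.symm c))
    rw [← Set.ncard_coe_finset]
    congr 1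
    ext s
    simp [h, ← map_sub, RingEquiv.eq_symm_apply]
  have hb : ∀ i j, i ≠ j → IsTriplyBalanced fun s => h i s - h j s := by
    intro i j hij c
    rcases lt_or_gt_of_ne hij with hlt | hlt
    · exact hb' i j hlt c
    · refine Eq.trans ?_ (hb' j i hlt (-c))
      congr 1
      ext s
      simp only [Finset.mem_filter, Finset.mem_univ, true_and, ← neg_sub (h i s), neg_inj]
  obtain ⟨a, b, d, hab, had, hbd, κ, hκ⟩ := exists_rows_sum_const (by simp) hb 0
  let x : Fin 9 → F := fun s => H b s - H a s
  have hadd : ∀ i, ∃ j β, ∀ s, x s + H i s = H j s + β := by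
    intro i
    obtain ⟨j, β, hj⟩ := exists_row_add_eq (by simp) hb hab had hbd hκ i
    refine ⟨j, φ.symm β, fun s => φ.injective ?_⟩
    simpa [x, h] using hj s
  have hx : x ∈ codeKernel (ghCode H) := by
    rw [mem_codeKernel_ghCode]
    intro α i
    have hα : α = 0 ∨ α = 1 ∨ α = 1 + 1 := by
      rcases zmod_three_cases (φ α) with hα | hα | hα
      · exact Or.inl (by simpa using hα)
      · exact Or.inr (Or.inl (by simpa using hα))
      · refine Or.inr (Or.inr (φ.injective ?_))
        rw [hα, map_add, map_one]
        rfl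
    rcases hα with rfl | rfl | rfl
    · exact ⟨i, 0, by simp⟩
    · simpa using hadd i
    · obtain ⟨j, β, hj⟩ := hadd i
      obtain ⟨j', β', hj'⟩ := hadd j
      exact ⟨j', β' + β, fun s => by linear_combination hj s + hj' s⟩
  by_contra hlt
  have h1 : Module.finrank F (codeKernel (ghCode H)) = 1 :=
    le_antisymm (by unfold kerDim at hlt; omega) (one_le_kerDim (by norm_num) H)
  have hone : (⟨1, one_mem_codeKernel_ghCode H⟩ : codeKernel (ghCode H)) ≠ 0 := by
    simp
  obtain ⟨c, hc⟩ := (finrank_eq_one_iff_of_nonzero' _ hone).1 h1 ⟨x, hx⟩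
  have hconst : ∀ s, H b s - H a s = c := fun s => by
    have := congrFun (congrArg Subtype.val hc) s
    simpa [x] using this.symm
  have h9 := hb b a hab.symm (φ c)
  simp [h, ← map_sub, hconst] at h9

theorem mainTheorem3 {F : Type*} [Field F] [Fintype F] (q : ℕ) (hcard : Fintype.card F = q)
    (hq : 2 < q) :
    (∀ h : ℕ, 2 ≤ h → ¬ (q = 3 ∧ h = 2) → ∀ k : ℕ,
      (∃ C : Set (Fin (q ^ h) → F), IsGHCode C ∧ kerDim C = k) ↔ 1 ≤ k ∧ k ≤ h + 1) ∧
    (q = 3 → ∀ k : ℕ,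
      (∃ C : Set (Fin 9 → F), IsGHCode C ∧ kerDim C = k) ↔ k = 2 ∨ k = 3) := by
  subst hcard
  refine ⟨fun h hh hqh k => ⟨?_, ?_⟩, fun h3 k => ⟨?_, fun hk => ?_⟩⟩
  · rintro ⟨_, ⟨lam, H, -, hn, rfl⟩, rfl⟩
    exact ⟨one_le_kerDim (pow_pos (by omega) h).ne' H, kerDim_ghCode_le rfl hn⟩
  · rintro ⟨hk1, hk2⟩
    obtain rfl | hk := hk1.eq_or_lt
    · exact exists_kerDim_one hq rfl hh hqh
    · exact exists_kerDim_eq hq rfl hk hk2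
  · rintro ⟨C, hC, rfl⟩
    have h2 := two_le_kerDim_of_card_eq_three h3 hC
    obtain ⟨lam, H, -, hn, rfl⟩ := hC
    have := kerDim_ghCode_le (h := 2) (by rw [h3]; norm_num) hn
    omega
  · exact exists_kerDim_eq hq (h := 2) (by rw [h3]; norm_num) (by omega) (by omega)
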